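/- For a nontrivial real Banach space $X$, a slice of the closed unit ball $B_X$ is a set $S(x^*,\alpha)=\{x\in B_X: x^*(x)>1-\alpha\}$ with $x^*\in X^*$, $\|x^*\|=1$ and $\alpha>0$. The space $X$ has the strong diameter $2$ property (SD2P) if $\sum_{i=1}^n\lambda_iS_i$ has diameter $2$ whenever $S_1,\dots,S_n$ are slices of $B_X$, $\lambda_i\ge 0$ and $\sum_{i=1}^n\lambda_i=1$. It has the symmetric strong diameter $2$ property (SSD2P) if for every $n\ge 1$, all slices $S_1,\dots,S_n$ of $B_X$ and every $\varepsilon>0$ there are $f_i\in S_i$ and $g\in B_X$ with $\|g\|>1-\varepsilon$ such that $f_i\pm g\in S_i$ for all $i$. If $X$ is a dual space, the $w^*$-SSD2P is defined in the same way, with slices replaced by weak$^*$ slices, that is, slices whose defining functional comes from the predual. For a metric space $M$ with base point $0$, $\mathrm{Lip}_0(M)$ is the Banach space of Lipschitz functions $f:M\to\mathbb R$ with $f(0)=0$, normed by the best Lipschitz constant. It is the dual of the Lipschitz-free space $\mathcal F(M)$, the norm closed linear span of the evaluations $\delta_x$ $(x\in M)$ in $\mathrm{Lip}_0(M)^*$,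 via $f\mapsto(\mu\mapsto\mu(f))$. The space $M$ has the SLTP if for every finite $N\subseteq M$ and every $\varepsilon>0$ there are $u\ne v$ in $M$ such that $$(1-\varepsilon)\bigl(d(x,y)+d(u,v)\bigr)\le d(x,u)+d(y,v),$$ $$(1-\varepsilon)\bigl(2d(u,v)+d(x,y)+d(z,w)\bigr)\le d(x,u)+d(y,u)+d(z,v)+d(w,v)$$ for all $x,y,z,w\in N$. Let $M=\{a_k,b_k,c_k: k\in\mathbb N\}$ (all these points being distinct) be the metric space in which $d(a_k,c_k)=2$ for every $k$, $d(a_k,b_l)=d(b_k,b_l)=d(c_k,b_l)=2$ for all $k<l$, and the distance between two different points is $1$ in all other cases. Then: 1. For every choice of the base point of $M$, the space $\mathrm{Lip}_0(M)$ has the SD2P, does not have the SSD2P, and has the $w^*$-SSD2P (with respect to its predual $\mathcal F(M)$). 2. $M$ has the SLTP. 3. Consequently, the SSD2P and the $w^*$-SSD2P are different properties for dual spaces: there is a Banach space $X$ such that $X^*$ has the $w^*$-SSD2P but not the SSD2P. -/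

import Mathlib

open scoped Pointwise

/-! ### Slices and diameter two properties -/

section DiameterTwo

variable {X : Type*} [NormedAddCommGroup X] [NormedSpace ℝ X]

/-- The set `S(φ, α) = {x ∈ B_X : φ x > 1 - α}`. It is a slice of the closed unit ball `B_X` when
`‖φ‖ = 1` and `α > 0`. -/
def sliceSet (φ : StrongDual ℝ X) (α : ℝ) : Set X :=
  {x | ‖x‖ ≤ 1 ∧ 1 - α < φ x}

/-- `S` is a slice of the closed unit ball of `X`. -/
def IsSlice (S : Set X) : Prop :=
  ∃ (φ : StrongDual ℝ X) (α : ℝ), ‖φ‖ = 1 ∧ 0 < α ∧ S = sliceSet φ α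

/-- The conclusion of the symmetric strong diameter two property for one finite family `S` of
subsets of the unit ball and one `ε`. -/
def SymmetricWitness {n : ℕ} (S : Fin n → Set X) (ε : ℝ) : Prop :=
  ∃ (f : Fin n → X) (g : X), ‖g‖ ≤ 1 ∧ 1 - ε < ‖g‖ ∧
    ∀ i, f i ∈ S i ∧ f i + g ∈ S i ∧ f i - g ∈ S i

variable (X) in
/-- Strong diameter two property: every convex combination of slices of the unit ball has
diameter `2`. -/
def HasSD2P : Prop :=
  ∀ (n : ℕ) (l : Fin n → ℝ) (S : Fin n → Set X),
    (∀ i, 0 ≤ l i) → ∑ i, l i = 1 → (∀ i, IsSlice (S i)) →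
      Metric.diam (∑ i, l i • S i) = 2

variable (X) in
/-- Symmetric strong diameter two property. -/
def HasSSD2P : Prop :=
  ∀ (n : ℕ), 0 < n → ∀ S : Fin n → Set X, (∀ i, IsSlice (S i)) →
    ∀ ε : ℝ, 0 < ε → SymmetricWitness S ε

/-- `S` is a weak* slice of the closed unit ball of the dual space `Y`, where `Y` is identified
with the dual of `X` by `e`: a slice whose defining functional is evaluation at a norm one
element of the predual `X`. -/
def IsWeakStarSlice {Y : Type*} [NormedAddCommGroup Y] [NormedSpace ℝ Y]
    (e : Y ≃ₗᵢ[ℝ] StrongDual ℝ X) (S : Set Y) : Prop :=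
  ∃ (x : X) (α : ℝ), ‖x‖ = 1 ∧ 0 < α ∧ S = {y : Y | ‖y‖ ≤ 1 ∧ 1 - α < e y x}

/-- Weak* symmetric strong diameter two property of the dual space `Y`, where `Y` is identified
with the dual of `X` by `e`. -/
def HasWeakStarSSD2P {Y : Type*} [NormedAddCommGroup Y] [NormedSpace ℝ Y]
    (e : Y ≃ₗᵢ[ℝ] StrongDual ℝ X) : Prop :=
  ∀ (n : ℕ), 0 < n → ∀ S : Fin n → Set Y, (∀ i, IsWeakStarSlice e (S i)) →
    ∀ ε : ℝ, 0 < ε → SymmetricWitness S ε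

end DiameterTwo

/-! ### The space of Lipschitz functions vanishing at the base point -/

/-- The real-valued Lipschitz functions on `M` that vanish at `p`, as a space of functions. -/
def lip0Submodule {M : Type*} [MetricSpace M] (p : M) : Submodule ℝ (M → ℝ) where
  carrier := {f | f p = 0 ∧ ∃ K : NNReal, LipschitzWith K f}
  zero_mem' := ⟨rfl, 0, LipschitzWith.const 0⟩
  add_mem' := by
    rintro f g ⟨hf, K, hK⟩ ⟨hg, L, hL⟩
    exact ⟨by simp [hf, hg], K + L, hK.add hL⟩
  smul_mem' := by
    rintro c f ⟨hf, K, hK⟩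
    exact ⟨by simp [hf], _, (lipschitzWith_smul c).comp hK⟩

/-- `Lip₀(M)` for the metric space `M` with base point `p`. -/
def Lip0 {M : Type*} [MetricSpace M] (p : M) : Type _ := ↥(lip0Submodule p)

namespace Lip0

variable {M : Type*} [MetricSpace M] {p : M}

instance (priority := low) instAddCommGroup : AddCommGroup (Lip0 p) := inferInstanceAs (AddCommGroup ↥(lip0Submodule p))

instance (priority := low) instModule : Module ℝ (Lip0 p) := inferInstanceAs (Module ℝ ↥(lip0Submodule p))

instance : CoeFun (Lip0 p) (fun _ => M → ℝ) := ⟨fun f => f.1⟩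

@[simp] theorem add_apply (f g : Lip0 p) (x : M) : (f + g) x = f x + g x := rfl

@[simp] theorem neg_apply (f : Lip0 p) (x : M) : (-f) x = -f x := rfl

@[simp] theorem sub_apply (f g : Lip0 p) (x : M) : (f - g) x = f x - g x := rfl

@[simp] theorem smul_apply (c : ℝ) (f : Lip0 p) (x : M) : (c • f) x = c * f x := rfl

@[simp] theorem zero_apply (x : M) : (0 : Lip0 p) x = 0 := rfl

@[simp] theorem apply_base (f : Lip0 p) : f p = 0 := f.2.1

@[ext] theorem ext {f g : Lip0 p} (h : ∀ x, f x = g x) : f = g := Subtype.ext (funext h)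

/-- The Lipschitz norm `sup { |f x - f y| / d(x, y) : x ≠ y }`. -/
noncomputable instance : Norm (Lip0 p) :=
  ⟨fun f => ⨆ q : {q : M × M // q.1 ≠ q.2}, |f q.1.1 - f q.1.2| / dist q.1.1 q.1.2⟩

theorem norm_def (f : Lip0 p) :
    ‖f‖ = ⨆ q : {q : M × M // q.1 ≠ q.2}, |f q.1.1 - f q.1.2| / dist q.1.1 q.1.2 := rfl

theorem bddAbove_slopes (f : Lip0 p) :
    BddAbove (Set.range fun q : {q : M × M // q.1 ≠ q.2} =>
      |f q.1.1 - f q.1.2| / dist q.1.1 q.1.2) := by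
  obtain ⟨K, hK⟩ := f.2.2
  refine ⟨K, ?_⟩
  rintro _ ⟨q, rfl⟩
  have hd : 0 < dist q.1.1 q.1.2 := dist_pos.2 q.2
  have h := hK.dist_le_mul q.1.1 q.1.2
  rw [Real.dist_eq] at h
  exact (div_le_iff₀ hd).2 h

theorem norm_nonneg' (f : Lip0 p) : 0 ≤ ‖f‖ :=
  Real.iSup_nonneg fun _ => div_nonneg (abs_nonneg _) dist_nonneg

theorem abs_sub_le (f : Lip0 p) (x y : M) : |f x - f y| ≤ ‖f‖ * dist x y := by
  by_cases h : x = y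
  · simp [h]
  · exact (div_le_iff₀ (dist_pos.2 h)).1 (le_ciSup (bddAbove_slopes f) ⟨(x, y), h⟩)

theorem norm_le_of (f : Lip0 p) {C : ℝ} (hC : 0 ≤ C)
    (h : ∀ x y, |f x - f y| ≤ C * dist x y) : ‖f‖ ≤ C :=
  Real.iSup_le (fun q => (div_le_iff₀ (dist_pos.2 q.2)).2 (h _ _)) hC

theorem abs_le (f : Lip0 p) (x : M) : |f x| ≤ ‖f‖ * dist x p := by
  simpa using abs_sub_le f x p

theorem core : NormedSpace.Core ℝ (Lip0 p) where
  norm_nonneg := norm_nonneg'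
  norm_smul c f := by
    rw [norm_def, norm_def, Real.norm_eq_abs, Real.mul_iSup_of_nonneg (abs_nonneg c)]
    congr 1
    funext q
    simp only [smul_apply]
    rw [← mul_sub, abs_mul, mul_div_assoc]
  norm_triangle f g := by
    refine norm_le_of _ (add_nonneg (norm_nonneg' f) (norm_nonneg' g)) fun x y => ?_
    have h : (f + g) x - (f + g) y = (f x - f y) + (g x - g y) := by
      simp only [add_apply]; ring
    rw [h, add_mul]
    exact (abs_add_le _ _).trans (add_le_add (abs_sub_le f x y) (abs_sub_le g x y))
  norm_eq_zero_iff f := by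
    constructor
    · intro h
      ext x
      have := abs_le f x
      rw [h, zero_mul] at this
      exact abs_eq_zero.1 (le_antisymm this (abs_nonneg _))
    · rintro rfl
      exact le_antisymm (norm_le_of _ le_rfl fun x y => by simp) (norm_nonneg' _)

noncomputable instance : NormedAddCommGroup (Lip0 p) := NormedAddCommGroup.ofCore core

noncomputable instance : NormedSpace ℝ (Lip0 p) := NormedSpace.ofCore core

/-- The evaluation functional `δ_x : f ↦ f x` on `Lip₀(M)`. -/
noncomputable def delta (x : M) : StrongDual ℝ (Lip0 p) :=
  LinearMap.mkContinuous
    { toFun := fun f => f x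
      map_add' := fun _ _ => rfl
      map_smul' := fun _ _ => rfl } (dist x p) fun f => by
    rw [Real.norm_eq_abs, mul_comm]
    exact abs_le f x

@[simp] theorem delta_apply (x : M) (f : Lip0 p) : delta x f = f x := rfl

theorem norm_delta_sub_le (x y : M) : ‖(delta x - delta y : StrongDual ℝ (Lip0 p))‖ ≤ dist x y :=
  ContinuousLinearMap.opNorm_le_bound _ dist_nonneg fun f => by
    rw [mul_comm]
    exact abs_sub_le f x y

variable (p) in
/-- The norm closed linear span of the evaluation functionals in the dual of `Lip₀(M)`. -/
noncomputable def freeSubmodule : Submodule ℝ (StrongDual ℝ (Lip0 p)) :=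
  (Submodule.span ℝ (Set.range fun x : M => (delta x : StrongDual ℝ (Lip0 p)))).topologicalClosure

end Lip0

/-- The Lipschitz-free space `F(M)`: the norm closed linear span of the evaluation functionals
in the dual of `Lip₀(M)`, with the norm of that dual. -/
def LipFree {M : Type*} [MetricSpace M] (p : M) : Type _ := ↥(Lip0.freeSubmodule p)

namespace LipFree

variable {M : Type*} [MetricSpace M] {p : M}

noncomputable instance : NormedAddCommGroup (LipFree p) :=
  inferInstanceAs (NormedAddCommGroup ↥(Lip0.freeSubmodule p))

noncomputable instance : NormedSpace ℝ (LipFree p) :=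
  inferInstanceAs (NormedSpace ℝ ↥(Lip0.freeSubmodule p))

instance : CompleteSpace (LipFree p) :=
  (Submodule.isClosed_topologicalClosure _).completeSpace_coe

variable (p) in
/-- The inclusion of `F(M)` in the dual of `Lip₀(M)`. -/
noncomputable def incl : LipFree p →ₗᵢ[ℝ] StrongDual ℝ (Lip0 p) where
  toFun μ := μ.1
  map_add' _ _ := rfl
  map_smul' _ _ := rfl
  norm_map' _ := rfl

/-- The evaluation functional `δ_x` as an element of `F(M)`. -/
noncomputable def delta (x : M) : LipFree p :=
  ⟨Lip0.delta x, Submodule.le_topologicalClosure _ (Submodule.subset_span ⟨x, rfl⟩)⟩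

@[simp] theorem incl_delta (x : M) : incl p (delta x) = Lip0.delta x := rfl

theorem norm_delta_sub_le (x y : M) : ‖(delta x - delta y : LipFree p)‖ ≤ dist x y :=
  Lip0.norm_delta_sub_le x y

/-- Two continuous linear functionals on `F(M)` that agree on all `δ_x` are equal. -/
theorem functional_ext {φ ψ : StrongDual ℝ (LipFree p)} (h : ∀ x, φ (delta x) = ψ (delta x)) :
    φ = ψ := by
  have hspan : ∀ (w : StrongDual ℝ (Lip0 p)) (hw : w ∈ Submodule.span ℝ
      (Set.range fun x : M => (Lip0.delta x : StrongDual ℝ (Lip0 p)))),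
      φ ⟨w, Submodule.le_topologicalClosure _ hw⟩
        = ψ ⟨w, Submodule.le_topologicalClosure _ hw⟩ := by
    intro w hw
    induction hw using Submodule.span_induction with
    | mem w hw => obtain ⟨x, rfl⟩ := hw; exact h x
    | zero => exact (map_zero φ).trans (map_zero ψ).symm
    | add v w hv hw ihv ihw =>
      exact (map_add φ ⟨v, _⟩ ⟨w, _⟩).trans
        ((congrArg₂ (· + ·) ihv ihw).trans (map_add ψ ⟨v, _⟩ ⟨w, _⟩).symm)
    | smul c v hv ihv =>
      exact (map_smul φ c ⟨v, _⟩).trans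
        ((congrArg (c • ·) ihv).trans (map_smul ψ c ⟨v, _⟩).symm)
  ext μ
  obtain ⟨u, hu, hlim⟩ := mem_closure_iff_seq_limit.1 μ.2
  let U : ℕ → LipFree p := fun n => ⟨u n, Submodule.le_topologicalClosure _ (hu n)⟩
  have hU : Filter.Tendsto U Filter.atTop (nhds μ) := tendsto_subtype_rng.2 hlim
  have h1 : Filter.Tendsto (fun n => φ (U n)) Filter.atTop (nhds (φ μ)) :=
    (φ.continuous.tendsto _).comp hU
  have h2 : Filter.Tendsto (fun n => ψ (U n)) Filter.atTop (nhds (ψ μ)) :=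
    (ψ.continuous.tendsto _).comp hU
  exact tendsto_nhds_unique h1 (h2.congr fun n => (hspan (u n) (hu n)).symm)

end LipFree

namespace Lip0

variable {M : Type*} [MetricSpace M] {p : M}

variable (p) in
/-- The canonical pairing: `f` acts on `F(M)` by `μ ↦ μ f`. -/
noncomputable def toDual : Lip0 p →ₗᵢ[ℝ] StrongDual ℝ (LipFree p) where
  toFun f := (NormedSpace.inclusionInDoubleDual ℝ (Lip0 p) f).comp
    (LipFree.incl p).toContinuousLinearMap
  map_add' f g := by ext μ; simp
  map_smul' c f := by ext μ; simp
  norm_map' f := by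
    refine le_antisymm ?_ ?_
    · refine ContinuousLinearMap.opNorm_le_bound _ (norm_nonneg _) fun μ => ?_
      rw [mul_comm]
      exact (LipFree.incl p μ).le_opNorm f
    · refine norm_le_of f (norm_nonneg _) fun x y => ?_
      have h := ((NormedSpace.inclusionInDoubleDual ℝ (Lip0 p) f).comp
        (LipFree.incl p).toContinuousLinearMap).le_opNorm (LipFree.delta x - LipFree.delta y)
      exact h.trans (mul_le_mul_of_nonneg_left (LipFree.norm_delta_sub_le x y) (norm_nonneg _))

@[simp] theorem toDual_apply (f : Lip0 p) (μ : LipFree p) :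
    toDual p f μ = LipFree.incl p μ f := rfl

theorem toDual_surjective : Function.Surjective (toDual p) := by
  intro φ
  have hDp : (LipFree.delta p : LipFree p) = 0 := by
    apply (LipFree.incl p).injective
    ext f
    simp
  have hlip : LipschitzWith ‖φ‖₊ (fun x => φ (LipFree.delta x)) := by
    refine LipschitzWith.of_dist_le_mul fun x y => ?_
    rw [dist_eq_norm, ← map_sub]
    exact (φ.le_opNorm _).trans
      (mul_le_mul_of_nonneg_left (LipFree.norm_delta_sub_le x y) (norm_nonneg _))
  exact ⟨⟨fun x => φ (LipFree.delta x), by simp [hDp], _, hlip⟩,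
    LipFree.functional_ext fun x => rfl⟩

variable (p) in
/-- The canonical isometric identification `Lip₀(M) = F(M)*`, `f ↦ (μ ↦ μ f)`. -/
noncomputable def dualIso : Lip0 p ≃ₗᵢ[ℝ] StrongDual ℝ (LipFree p) :=
  LinearIsometryEquiv.ofSurjective (toDual p) toDual_surjective

@[simp] theorem dualIso_apply (f : Lip0 p) (μ : LipFree p) :
    dualIso p f μ = LipFree.incl p μ f := rfl

/-- `Lip₀(M)` is a Banach space. -/
instance : CompleteSpace (Lip0 p) :=
  (completeSpace_congr (dualIso p).toIsometryEquiv.isometry.isUniformEmbedding).2 inferInstance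

end Lip0

/-! ### The strong long trapezoid property -/

/-- The strong long trapezoid property (SLTP) of a metric space. -/
def HasSLTP (M : Type*) [MetricSpace M] : Prop :=
  ∀ (N : Set M), N.Finite → ∀ ε : ℝ, 0 < ε → ∃ u v : M, u ≠ v ∧
    (∀ x ∈ N, ∀ y ∈ N, (1 - ε) * (dist x y + dist u v) ≤ dist x u + dist y v) ∧
    (∀ x ∈ N, ∀ y ∈ N, ∀ z ∈ N, ∀ w ∈ N,
      (1 - ε) * (2 * dist u v + dist x y + dist z w)
        ≤ dist x u + dist y u + dist z v + dist w v)

/-! ### The metric space `{a_k, b_k, c_k : k ∈ ℕ}` -/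

/-- The underlying set `{a_k, b_k, c_k : k ∈ ℕ}`. The distances below depend only on the order
of the indices, so it does not matter that they start at `0`. -/
inductive ABC : Type
  | a (k : ℕ) : ABC
  | b (k : ℕ) : ABC
  | c (k : ℕ) : ABC

namespace ABC

/-- `d(a_k, c_k) = 2` for all `k`; `d(a_k, b_l) = d(b_k, b_l) = d(c_k, b_l) = 2` for `k < l`;
all other distances between different points are `1`. -/
def distance : ABC → ABC → ℝ
  | a k, a l => if k = l then 0 else 1
  | b k, b l => if k = l then 0 else 2
  | c k, c l => if k = l then 0 else 1
  | a k, c l => if k = l then 2 else 1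
  | c k, a l => if k = l then 2 else 1
  | a k, b l => if k < l then 2 else 1
  | b l, a k => if k < l then 2 else 1
  | c k, b l => if k < l then 2 else 1
  | b l, c k => if k < l then 2 else 1

theorem distance_self (x : ABC) : distance x x = 0 := by
  cases x <;> simp [distance]

theorem distance_comm (x y : ABC) : distance x y = distance y x := by
  cases x <;> cases y <;> simp [distance, eq_comm]

theorem distance_le_two (x y : ABC) : distance x y ≤ 2 := by
  cases x <;> cases y <;> simp only [distance] <;> split_ifs <;> norm_num

theorem one_le_distance {x y : ABC} (h : x ≠ y) : 1 ≤ distance x y := by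
  cases x <;> cases y <;> simp only [distance] <;> split_ifs <;> simp_all

noncomputable instance : MetricSpace ABC where
  dist := distance
  dist_self := distance_self
  dist_comm := distance_comm
  dist_triangle x y z := by
    by_cases hxy : x = y
    · simp [hxy, distance_self]
    by_cases hyz : y = z
    · simp [hyz, distance_self]
    linarith [one_le_distance hxy, one_le_distance hyz, distance_le_two x z]
  eq_of_dist_eq_zero {x y} h := by
    by_contra hne
    have h' : distance x y = 0 := h
    linarith [one_le_distance hne]

theorem dist_def (x y : ABC) : dist x y = distance x y := rfl

end ABC

/-!
Seen from a fixed finite part of `M = {a_k, b_k, c_k}`, the points `b_m` with large `m` are as far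
away as possible, while `a_m` and `c_m` are as close as possible. The two positive results use
these two features, and the negative one their interplay.

*Far apart.* If `m` exceeds all indices occurring in a finite set `N`, then `b_m` and `b_{m+1}`
lie at distance `2`, the diameter of `M`, from each other and from `N`. This gives the SLTP at
once. A norm one element of `F(M)` is almost supported on the points of index less than `m`,
and a function `h` in the unit ball of `Lip₀(M)` can be replaced beyond these points by a
constant `i` with `|h - i| ≤ 1`; adding or subtracting `1_{b_m} - 1_{b_{m+1}}` then keeps the
Lipschitz constant at most `1`. This gives the weak* SSD2P.

*Close together.* Every point is at distance `1` from `a_l` and `c_l` for all large `l`. If `h` is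
`1`-Lipschitz and `i = liminf_l min (h a_l) (h c_l)`, it follows that `|h - i| ≤ 1`
(`ABC.exists_center`), and for large `m` the values of `h` at `b_m` and `a_m` may be changed to
`i + 1 - ε` and `i` without losing the Lipschitz constant `1`. A functional on `Lip₀(M)`
hardly notices the change, because the evaluations of a functional at the indicators of distinct
points are absolutely summable. So every slice contains functions with slope nearly `1`, and by
symmetry nearly `-1`, from `a_m` to `b_m`, with an `m` common to finitely many slices. This gives
the SD2P.

*The obstruction to the SSD2P.* Let `g` be symmetrically admissible for two slices. The first is
given by `f ↦ (f a₀ - f c₀) / 2`; since every `a_k`, `c_k` with `k > 0` is at distance `1` from `a₀`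
and `c₀`, it forces `g` to be almost constant, with value `t`, on all `a_k` and `c_k`. The second is
given by a weak* limit of `f ↦ f a_k - f c_{k+1}`. A function in it differs by almost `1`
between some `a_k` and `c_{k+1}`, both at distance `1` from a given `b_m`, and so the value at
`b_m` can move in both directions by little more than `1/2` only. Hence `‖g‖` is bounded away
from `1`.
-/

open Filter Topology

/-! ### Slices, limits of functionals, and change of the dual space -/

section Functionals

variable {X : Type*} [NormedAddCommGroup X] [NormedSpace ℝ X]

theorem exists_mem_sliceSet {φ : StrongDual ℝ X} (hφ : ‖φ‖ = 1) {α : ℝ} (hα : 0 < α) :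
    ∃ x, x ∈ sliceSet φ α := by
  obtain ⟨x, hx, h⟩ := φ.exists_lt_apply_of_lt_opNorm (r := 1 - α) (by linarith)
  rw [Real.norm_eq_abs, lt_abs] at h
  rcases h with h | h
  · exact ⟨x, hx.le, h⟩
  · exact ⟨-x, by simpa using hx.le, by simpa using h⟩

/-- By Banach-Alaoglu, a bounded sequence of functionals converges pointwise along a free
ultrafilter. -/
theorem exists_tendsto_hyperfilter (s : ℕ → StrongDual ℝ X) (hs : ∀ k, ‖s k‖ ≤ 1) :
    ∃ φ : StrongDual ℝ X, ‖φ‖ ≤ 1 ∧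
      ∀ x, Tendsto (fun k => s k x) (hyperfilter ℕ : Filter ℕ) (𝓝 (φ x)) := by
  have hK := WeakDual.isCompact_closedBall (𝕜 := ℝ) (E := X) 0 1
  obtain ⟨φ, hφ, hlim⟩ := hK.ultrafilter_le_nhds
    ((hyperfilter ℕ).map fun k => StrongDual.toWeakDual (s k)) (by
      rw [Ultrafilter.coe_map, le_principal_iff]
      refine Filter.mem_map.2 (univ_mem' fun k => ?_)
      simpa using hs k)
  refine ⟨WeakDual.toStrongDual φ, by simpa using hφ, fun x => ?_⟩
  exact ((WeakDual.eval_continuous x).tendsto φ).comp hlim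

theorem norm_eq_one_of_le_of_apply {φ : StrongDual ℝ X} (hφ : ‖φ‖ ≤ 1) {x : X} (hx : ‖x‖ ≤ 1)
    (h : φ x = 1) : ‖φ‖ = 1 := by
  refine le_antisymm hφ ?_
  have h1 := φ.le_opNorm x
  rw [h, norm_one] at h1
  nlinarith [norm_nonneg φ]

variable {Y : Type*} [NormedAddCommGroup Y] [NormedSpace ℝ Y]

theorem SymmetricWitness.of_preimage {n : ℕ} {S : Fin n → Set X} {ε : ℝ} (e : Y ≃ₗᵢ[ℝ] X)
    (h : SymmetricWitness (fun i => e ⁻¹' S i) ε) : SymmetricWitness S ε := by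
  obtain ⟨f, g, h1, h2, h3⟩ := h
  refine ⟨fun i => e (f i), e g, by simpa using h1, by simpa using h2, fun i => ?_⟩
  simpa using h3 i

theorem IsSlice.preimage {S : Set X} (hS : IsSlice S) (e : Y ≃ₗᵢ[ℝ] X) : IsSlice (e ⁻¹' S) := by
  obtain ⟨φ, α, hφ, hα, hS⟩ := hS
  subst hS
  refine ⟨φ.comp (e : Y →L[ℝ] X), α, ?_, hα, ?_⟩
  · rw [← hφ]
    exact φ.opNorm_comp_linearIsometryEquiv e
  · ext y
    simp [sliceSet]

theorem HasSSD2P.of_linearIsometryEquiv (h : HasSSD2P X) (e : X ≃ₗᵢ[ℝ] Y) : HasSSD2P Y :=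
  fun n hn _ hS ε hε => .of_preimage e (h n hn _ (fun i => (hS i).preimage e) ε hε)

theorem HasWeakStarSSD2P.strongDual {e : Y ≃ₗᵢ[ℝ] StrongDual ℝ X} (h : HasWeakStarSSD2P e) :
    HasWeakStarSSD2P (LinearIsometryEquiv.refl ℝ (StrongDual ℝ X)) := by
  intro n hn S hS ε hε
  refine .of_preimage e (h n hn _ (fun i => ?_) ε hε)
  obtain ⟨x, α, hx, hα, hSi⟩ := hS i
  refine ⟨x, α, hx, hα, ?_⟩
  ext y
  simp [hSi]

end Functionals

/-! ### Lipschitz functions and their values at finitely many points -/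

theorem abs_update_sub_update_le {M : Type*} [MetricSpace M] [DecidableEq M] {h : M → ℝ}
    (hh : ∀ x y, |h x - h y| ≤ dist x y) {u : M} {v : ℝ}
    (hv : ∀ y, y ≠ u → |v - h y| ≤ dist u y) (x y : M) :
    |Function.update h u v x - Function.update h u v y| ≤ dist x y := by
  by_cases hx : x = u <;> by_cases hy : y = u
  · simp [hx, hy]
  · simpa [hx, hy] using hv y hy
  · rw [abs_sub_comm, dist_comm]
    simpa [hx, hy] using hv x hx
  · simpa [hx, hy] using hh x y

namespace Lip0

variable {M : Type*} [MetricSpace M] {p : M}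

variable (p) in
/-- The Lipschitz function `f`, shifted by a constant so as to vanish at the base point. -/
def ofLipschitz (f : M → ℝ) {C : ℝ} (hf : ∀ x y, |f x - f y| ≤ C * dist x y) : Lip0 p :=
  ⟨fun x => f x - f p, by simp, C.toNNReal, LipschitzWith.of_dist_le_mul fun x y => by
    rw [Real.dist_eq, sub_sub_sub_cancel_right]
    exact (hf x y).trans (mul_le_mul_of_nonneg_right (Real.le_coe_toNNReal C) dist_nonneg)⟩

@[simp] theorem ofLipschitz_apply (f : M → ℝ) {C : ℝ} (hf : ∀ x y, |f x - f y| ≤ C * dist x y)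
    (x : M) : ofLipschitz p f hf x = f x - f p := rfl

theorem norm_ofLipschitz_le (f : M → ℝ) {C : ℝ} (hC : 0 ≤ C)
    (hf : ∀ x y, |f x - f y| ≤ C * dist x y) : ‖ofLipschitz p f hf‖ ≤ C :=
  norm_le_of _ hC fun x y => by simpa using hf x y

theorem abs_sub_le_dist {f : Lip0 p} (hf : ‖f‖ ≤ 1) (x y : M) : |f x - f y| ≤ dist x y :=
  (abs_sub_le f x y).trans (mul_le_of_le_one_left dist_nonneg hf)

/-- A `1`-Lipschitz function vanishing at the base point, as an element of the unit ball. -/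
theorem exists_of_dist (f : M → ℝ) (hf : ∀ x y, |f x - f y| ≤ dist x y) (hp : f p = 0) :
    ∃ F : Lip0 p, ‖F‖ ≤ 1 ∧ ∀ x, F x = f x :=
  ⟨ofLipschitz p f (C := 1) (by simpa using hf), norm_ofLipschitz_le f zero_le_one _,
    fun x => by simp [hp]⟩

theorem coe_sum {ι : Type*} (s : Finset ι) (F : ι → Lip0 p) (x : M) :
    (∑ i ∈ s, F i) x = ∑ i ∈ s, F i x := by
  simp only [← delta_apply, map_sum]

/-- In a space whose nonzero distances are at least `1`, the Lipschitz constant is controlled by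
the uniform norm, so the evaluations of a functional on `Lip₀(M)` at functions supported at
different points are absolutely summable. -/
theorem tendsto_apply_of_disjoint (hM : ∀ x y : M, x ≠ y → 1 ≤ dist x y)
    {x : ℕ → M} (hx : Function.Injective x) (F : ℕ → Lip0 p)
    (hF : ∀ m y, y ≠ x m → F m y = 0) (hF1 : ∀ m, |F m (x m)| ≤ 1)
    (φ : StrongDual ℝ (Lip0 p)) :
    Tendsto (fun m => φ (F m)) atTop (𝓝 0) := by
  have key : ∀ s : Finset ℕ, ∑ m ∈ s, |φ (F m)| ≤ ‖φ‖ * 2 := by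
    intro s
    let G : Lip0 p := ∑ m ∈ s, (SignType.sign (φ (F m)) : ℝ) • F m
    have hG : ∀ y, |G y| ≤ 1 := by
      intro y
      simp only [G, coe_sum, smul_apply]
      by_cases hy : ∃ m, x m = y
      · obtain ⟨m, rfl⟩ := hy
        have hz : ∀ k ∈ s, k ≠ m → (SignType.sign (φ (F k)) : ℝ) * F k (x m) = 0 :=
          fun k _ hk => by rw [hF k _ fun h => hk (hx h).symm, mul_zero]
        by_cases hm : m ∈ s
        · rw [Finset.sum_eq_single_of_mem m hm hz, abs_mul]
          refine mul_le_one₀ ?_ (abs_nonneg _) (hF1 m)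
          rcases SignType.sign (φ (F m)) with _ | _ | _ <;> simp
        · rw [Finset.sum_eq_zero fun k hk => hz k hk fun h => hm (h ▸ hk)]
          simp
      · rw [Finset.sum_eq_zero fun k _ => by rw [hF k y fun h => hy ⟨k, h.symm⟩, mul_zero]]
        simp
    have hGn : ‖G‖ ≤ 2 := by
      refine norm_le_of G zero_le_two fun y z => ?_
      by_cases hyz : y = z
      · simp [hyz]
      · have h1 := abs_sub (G y) (G z)
        linarith [hG y, hG z, hM y z hyz]
    calc ∑ m ∈ s, |φ (F m)| = φ G := by simp [G, map_sum, sign_mul_self]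
      _ ≤ ‖φ G‖ := le_abs_self _
      _ ≤ ‖φ‖ * ‖G‖ := φ.le_opNorm G
      _ ≤ ‖φ‖ * 2 := by gcongr
  exact ((summable_of_sum_le (fun _ => abs_nonneg _) key).of_abs).tendsto_atTop_zero

end Lip0

/-! ### Geometry of the space -/

namespace ABC

/-- The index `k` of the points `a_k`, `b_k`, `c_k`. -/
def index : ABC → ℕ
  | a k => k
  | b k => k
  | c k => k

noncomputable instance : DecidableEq ABC := Classical.decEq _

theorem dist_le_two (x y : ABC) : dist x y ≤ 2 := distance_le_two x y

theorem one_le_dist {x y : ABC} (h : x ≠ y) : 1 ≤ dist x y := one_le_distance h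

theorem dist_b_of_index_lt {x : ABC} {m : ℕ} (h : x.index < m) : dist x (b m) = 2 := by
  cases x <;> simp_all [dist_def, distance, index]
  omega

theorem dist_a_of_index_lt {x : ABC} {m : ℕ} (h : x.index < m) : dist x (a m) = 1 := by
  cases x <;> simp_all [dist_def, distance, index] <;> omega

theorem dist_c_of_index_lt {x : ABC} {m : ℕ} (h : x.index < m) : dist x (c m) = 1 := by
  cases x <;> simp_all [dist_def, distance, index] <;> omega

theorem dist_b_b {k l : ℕ} (h : k ≠ l) : dist (b k) (b l) = 2 := by
  simp [dist_def, distance, h]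

theorem dist_a_b_of_le {l m : ℕ} (h : m ≤ l) : dist (a l) (b m) = 1 := by
  simp [dist_def, distance, h]

theorem dist_c_b_of_le {l m : ℕ} (h : m ≤ l) : dist (c l) (b m) = 1 := by
  simp [dist_def, distance, h]

theorem dist_a_c_self (k : ℕ) : dist (a k) (c k) = 2 := by
  simp [dist_def, distance]

theorem dist_a_c {k l : ℕ} (h : k ≠ l) : dist (a k) (c l) = 1 := by
  simp [dist_def, distance, h]

theorem dist_b_eq_two_or (m : ℕ) {x : ABC} (h : x ≠ b m) :
    dist (b m) x = 2 ∨ ∃ l, m ≤ l ∧ (x = a l ∨ x = c l) := by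
  cases x <;> simp_all [dist_def, distance]
  all_goals omega

/-- The function `1_{b_m} - 1_{b_{m+1}}`. -/
noncomputable def bump (m : ℕ) : ABC → ℝ :=
  Function.update (Function.update 0 (b m) 1) (b (m + 1)) (-1)

theorem bump_of_ne {m : ℕ} {x : ABC} (h : x ≠ b m) (h' : x ≠ b (m + 1)) : bump m x = 0 := by
  simp [bump, h, h']

theorem bump_b (m : ℕ) : bump m (b m) = 1 := by simp [bump]

theorem bump_b_succ (m : ℕ) : bump m (b (m + 1)) = -1 := by simp [bump]

theorem bump_of_index_lt {m : ℕ} {x : ABC} (h : x.index < m) : bump m x = 0 := by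
  apply bump_of_ne <;> rintro rfl <;> simp [index] at h

theorem abs_bump_sub_le (m : ℕ) (x y : ABC) : |bump m x - bump m y| ≤ dist x y := by
  refine abs_update_sub_update_le (abs_update_sub_update_le ?_ ?_) ?_ x y
  · intro x y
    simp
  · intro y hy
    simpa using one_le_dist hy.symm
  · intro y hy
    by_cases h : y = b m
    · subst h
      rw [dist_b_b (by omega)]
      norm_num
    · simpa [h] using one_le_dist hy.symm

/-! ### The lower cluster value of a function along `a_l`, `c_l` -/

/-- For a `1`-Lipschitz `h` the number `i = liminf_l min (h a_l) (h c_l)` is within `1` of all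
values of `h`, because every point is at distance `1` from `a_l` and `c_l` for all large `l`. -/
theorem exists_center {h : ABC → ℝ} (hh : ∀ x y, |h x - h y| ≤ dist x y) :
    ∃ i : ℝ, (∀ x, |h x - i| ≤ 1) ∧
      ∀ ε > 0, ∀ᶠ l in atTop, i - ε ≤ h (a l) ∧ i - ε ≤ h (c l) := by
  let v : ℕ → ℝ := fun l => min (h (a l)) (h (c l))
  have hv : ∀ x, ∀ᶠ l in atTop, |h x - v l| ≤ 1 := by
    intro x
    filter_upwards [eventually_gt_atTop x.index] with l hl
    rcases min_choice (h (a l)) (h (c l)) with h' | h'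
    · simpa only [v, h', dist_a_of_index_lt hl] using hh x (a l)
    · simpa only [v, h', dist_c_of_index_lt hl] using hh x (c l)
  have hlo : atTop.IsBoundedUnder (· ≥ ·) v :=
    ⟨h (a 0) - 1, eventually_map.2 <| (hv (a 0)).mono fun l hl => by
      linarith [(abs_le.1 hl).2]⟩
  have hup : atTop.IsBoundedUnder (· ≤ ·) v :=
    ⟨h (a 0) + 1, eventually_map.2 <| (hv (a 0)).mono fun l hl => by
      linarith [(abs_le.1 hl).1]⟩
  have hev : ∀ ε > 0, ∀ᶠ l in atTop, liminf v atTop - ε < v l := fun ε hε =>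
    eventually_lt_of_lt_liminf (by linarith) hlo
  refine ⟨liminf v atTop, fun x => ?_, fun ε hε => (hev ε hε).mono fun l hl => ?_⟩
  · refine le_of_forall_pos_le_add fun ε hε => ?_
    have hfr : ∃ᶠ l in atTop, v l < liminf v atTop + ε :=
      frequently_lt_of_liminf_lt hup.isCoboundedUnder_ge (by linarith)
    obtain ⟨l, hl, hl1, hl2⟩ := (hfr.and_eventually ((hv x).and (hev ε hε))).exists
    rw [abs_le] at hl1 ⊢
    constructor <;> linarith
  · exact ⟨hl.le.trans (min_le_left _ _), hl.le.trans (min_le_right _ _)⟩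

/-! ### The strong long trapezoid property -/

theorem hasSLTP : HasSLTP ABC := by
  intro N hN ε hε
  obtain ⟨m, hm⟩ : ∃ m, ∀ x ∈ N, index x < m := by
    obtain ⟨m, hm⟩ := (hN.image index).bddAbove
    exact ⟨m + 1, fun x hx => Nat.lt_succ_of_le (hm ⟨x, hx, rfl⟩)⟩
  have hu : ∀ x ∈ N, dist x (b m) = 2 := fun x hx => dist_b_of_index_lt (hm x hx)
  have hv : ∀ x ∈ N, dist x (b (m + 1)) = 2 :=
    fun x hx => dist_b_of_index_lt ((hm x hx).trans (Nat.lt_succ_self m))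
  have huv : dist (b m) (b (m + 1)) = 2 := dist_b_b (by omega)
  refine ⟨b m, b (m + 1), by simp, fun x hx y hy => ?_, fun x hx y hy z hz w hw => ?_⟩
  · rw [hu x hx, hv y hy, huv]
    nlinarith [dist_le_two x y, dist_nonneg (x := x) (y := y)]
  · rw [hu x hx, hu y hy, hv z hz, hv w hw, huv]
    nlinarith [dist_le_two x y, dist_nonneg (x := x) (y := y), dist_le_two z w,
      dist_nonneg (x := z) (y := w)]

variable {p : ABC}

/-! ### The weak* symmetric strong diameter two property -/

/-- On the unit ball of `Lip₀(M)`, an element of `F(M)` depends up to `ε` only on the values at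
finitely many points. -/
theorem eventually_abs_apply_sub_le (μ : LipFree p) {ε : ℝ} (hε : 0 < ε) :
    ∀ᶠ m in atTop, ∀ f h : Lip0 p, ‖f‖ ≤ 1 → ‖h‖ ≤ 1 → (∀ x, index x < m → f x = h x) →
      |Lip0.dualIso p f μ - Lip0.dualIso p h μ| ≤ ε := by
  have hspan : ∀ ν ∈ Submodule.span ℝ
      (Set.range fun x : ABC => (Lip0.delta x : StrongDual ℝ (Lip0 p))),
      ∀ᶠ m in atTop, ∀ f h : Lip0 p, (∀ x, index x < m → f x = h x) → ν f = ν h := by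
    intro ν hν
    induction hν using Submodule.span_induction with
    | mem ν hν =>
      obtain ⟨x, rfl⟩ := hν
      filter_upwards [eventually_gt_atTop x.index] with m hm f h hfh using hfh x hm
    | zero => simp
    | add ν ξ _ _ hν hξ =>
      filter_upwards [hν, hξ] with m h1 h2 f h hfh
      simp [h1 f h hfh, h2 f h hfh]
    | smul r ν _ hν =>
      filter_upwards [hν] with m h1 f h hfh
      simp [h1 f h hfh]
  obtain ⟨ν, hν, hμν⟩ := Metric.mem_closure_iff.1 μ.2 (ε / 2) (half_pos hε)
  rw [dist_eq_norm] at hμν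
  filter_upwards [hspan ν hν] with m hm f h hf hh hfh
  have h1 : Lip0.dualIso p f μ - Lip0.dualIso p h μ = (μ.1 - ν) (f - h) := by
    have := hm f h hfh
    have h2 : (μ.1 - ν) (f - h) = (LipFree.incl p μ f - LipFree.incl p μ h) - (ν f - ν h) := by
      rw [map_sub]
      exact sub_sub_sub_comm _ _ _ _
    rw [h2, this, sub_self, sub_zero]
    rfl
  have h2 : ‖f - h‖ ≤ 2 := (norm_sub_le f h).trans (by linarith)
  rw [h1]
  calc |(μ.1 - ν) (f - h)| ≤ ‖μ.1 - ν‖ * ‖f - h‖ := (μ.1 - ν).le_opNorm _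
    _ ≤ ε / 2 * 2 := by gcongr
    _ = ε := by ring

/-- Beyond the points of index less than `m`, a function in the unit ball may be replaced by
a constant plus a multiple `s ∈ [-1, 1]` of `1_{b_m} - 1_{b_{m+1}}`. -/
theorem exists_truncation {h : Lip0 p} (hh : ‖h‖ ≤ 1) {m : ℕ} (hp : p.index < m) :
    ∃ i : ℝ, ∀ s : ℝ, |s| ≤ 1 → ∃ f : Lip0 p, ‖f‖ ≤ 1 ∧
      ∀ x, f x = (if index x < m then h x else i) + s * bump m x := by
  have hd := Lip0.abs_sub_le_dist hh
  obtain ⟨i, hi, -⟩ := exists_center hd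
  refine ⟨i, fun s hs => Lip0.exists_of_dist _ ?_ (by simp [hp, bump_of_index_lt])⟩
  have hmix : ∀ x y, index x < m → ¬ index y < m →
      |h x + s * bump m x - (i + s * bump m y)| ≤ dist x y := by
    intro x y hx hy
    have hxy : x ≠ y := by rintro rfl; exact hy hx
    rw [bump_of_index_lt hx]
    have hix := abs_le.1 (hi x)
    have hs' := abs_le.1 hs
    by_cases h1 : y = b m
    · rw [h1, bump_b, dist_b_of_index_lt hx, abs_le]
      constructor <;> linarith
    by_cases h2 : y = b (m + 1)
    · rw [h2, bump_b_succ, dist_b_of_index_lt (hx.trans (Nat.lt_succ_self m)), abs_le]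
      constructor <;> linarith
    rw [bump_of_ne h1 h2]
    simpa using (hi x).trans (one_le_dist hxy)
  intro x y
  by_cases hx : index x < m <;> by_cases hy : index y < m
  · simpa [hx, hy, bump_of_index_lt] using hd x y
  · simpa [hx, hy] using hmix x y hx hy
  · rw [abs_sub_comm, dist_comm]
    simpa [hx, hy] using hmix y x hy hx
  · simp only [hx, hy, if_false, add_sub_add_left_eq_sub, ← mul_sub, abs_mul]
    exact (mul_le_of_le_one_left (abs_nonneg _) hs).trans (abs_bump_sub_le m x y)

theorem hasWeakStarSSD2P (p : ABC) : HasWeakStarSSD2P (Lip0.dualIso p) := by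
  intro n _ S hS ε hε
  choose μ α hμ hα hSeq using hS
  -- Functions in the slices, which exist because `F(M)*` is norming for `F(M)`.
  have hne : ∀ i, ∃ h : Lip0 p, ‖h‖ ≤ 1 ∧ 1 - α i < Lip0.dualIso p h (μ i) := by
    intro i
    obtain ⟨φ, hφ, hφμ⟩ := exists_dual_vector ℝ (μ i) (by simp [hμ i])
    refine ⟨(Lip0.dualIso p).symm φ, by simp [hφ], ?_⟩
    rw [LinearIsometryEquiv.apply_symm_apply, hφμ, hμ i]
    simpa using hα i
  choose h hh hhμ using hne
  obtain ⟨m, hpm, hm⟩ : ∃ m, p.index < m ∧ ∀ i, ∀ f k : Lip0 p, ‖f‖ ≤ 1 → ‖k‖ ≤ 1 →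
      (∀ x, index x < m → f x = k x) → |Lip0.dualIso p f (μ i) - Lip0.dualIso p k (μ i)| ≤
        (Lip0.dualIso p (h i) (μ i) - (1 - α i)) / 2 :=
    ((eventually_gt_atTop p.index).and (eventually_all.2 fun i =>
      eventually_abs_apply_sub_le (μ i) (half_pos (sub_pos.2 (hhμ i))))).exists
  have hmem : ∀ i (f : Lip0 p), ‖f‖ ≤ 1 → (∀ x, index x < m → f x = h i x) → f ∈ S i := by
    intro i f hf hfh
    have h1 := abs_le.1 (hm i f (h i) hf (hh i) hfh)
    rw [hSeq i]
    exact ⟨hf, by linarith [hhμ i]⟩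
  choose c hc using fun i => exists_truncation (hh i) hpm
  choose f hf hfx using fun i => hc i 0 (by simp)
  choose f₁ hf₁ hfx₁ using fun i => hc i 1 (by simp)
  choose f₂ hf₂ hfx₂ using fun i => hc i (-1) (by simp)
  obtain ⟨g, hg, hgx⟩ := Lip0.exists_of_dist (bump m) (abs_bump_sub_le m) (bump_of_index_lt hpm)
  refine ⟨f, g, hg, ?_, fun i => ⟨hmem i _ (hf i) ?_, ?_, ?_⟩⟩
  · have h1 := Lip0.abs_sub_le g (b m) (b (m + 1))
    rw [hgx, hgx, bump_b, bump_b_succ, dist_b_b (by omega)] at h1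
    norm_num at h1
    linarith
  · intro x hx
    simp [hfx, hx]
  · have h1 : f i + g = f₁ i := by
      ext x
      simp [hfx, hfx₁, hgx]
    rw [h1]
    refine hmem i _ (hf₁ i) fun x hx => ?_
    simp [hfx₁, hx, bump_of_index_lt]
  · have h1 : f i - g = f₂ i := by
      ext x
      simp [hfx, hfx₂, hgx, sub_eq_add_neg]
    rw [h1]
    refine hmem i _ (hf₂ i) fun x hx => ?_
    simp [hfx₂, hx, bump_of_index_lt]

/-! ### The strong diameter two property -/

/-- Every slice contains functions with slope almost `1` from `a_m` to `b_m`, for all large `m`. -/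
theorem eventually_exists_slope {φ : StrongDual ℝ (Lip0 p)} {α : ℝ} {h : Lip0 p}
    (hh : h ∈ sliceSet φ α) {ε : ℝ} (hε : 0 < ε) (hε1 : ε ≤ 1) :
    ∀ᶠ m in atTop, ∃ f ∈ sliceSet φ α, f (b m) - f (a m) = 1 - ε := by
  have hd := Lip0.abs_sub_le_dist hh.1
  obtain ⟨i, hi, hlim⟩ := exists_center hd
  have hsmall : ∀ x : ℕ → ABC, Function.Injective x → (∀ m, (x m).index = m) → ∀ C > 0,
      ∀ᶠ m in atTop, ∀ f k : Lip0 p, (∀ y, y ≠ x m → f y = k y) → |f (x m) - k (x m)| ≤ 2 →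
        |φ f - φ k| < C := by
    intro x hx hxi C hC
    classical
    -- The indicator of `x m`, or `0` if `x m` is the base point.
    have hF : ∀ m, ∃ F : Lip0 p, (∀ y, y ≠ x m → F y = 0) ∧ F (x m) = if x m = p then 0 else 1 := by
      intro m
      by_cases hp : x m = p
      · exact ⟨0, by simp, by simp [hp]⟩
      · obtain ⟨F, -, hF⟩ := Lip0.exists_of_dist (p := p) (Function.update 0 (x m) 1)
          (abs_update_sub_update_le (by simp) fun y hy => by simpa using one_le_dist hy.symm)
          (by simp [Ne.symm hp])
        exact ⟨F, fun y hy => by simp [hF, hy], by simp [hF, hp]⟩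
    choose F hF0 hF1 using hF
    have hlim := Lip0.tendsto_apply_of_disjoint (fun _ _ => one_le_dist) hx F hF0
      (fun m => by rw [hF1]; split_ifs <;> simp) φ
    filter_upwards [(Metric.tendsto_nhds.1 hlim) (C / 2) (half_pos hC)] with m hm f k hfk hfk2
    have hfF : f - k = (f (x m) - k (x m)) • F m := by
      ext y
      by_cases hy : y = x m
      · subst hy
        by_cases hp : x m = p
        · simp [hp]
        · simp [hF1, hp]
      · simp [hF0 m y hy, hfk y hy]
    rw [← map_sub, hfF, map_smul, smul_eq_mul, abs_mul]
    rw [Real.dist_eq, sub_zero] at hm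
    nlinarith [abs_nonneg (φ (F m)), abs_nonneg (f (x m) - k (x m))]
  have hδ : 0 < (φ h - (1 - α)) / 2 := by linarith [hh.2]
  filter_upwards [eventually_gt_atTop p.index, eventually_forall_ge_atTop.2 (hlim ε hε),
    hsmall a (fun _ _ h => by simpa using h) (fun _ => rfl) _ hδ,
    hsmall b (fun _ _ h => by simpa using h) (fun _ => rfl) _ hδ] with m hpm hm ha hb
  have hpa : p ≠ a m := by rintro rfl; simp [index] at hpm
  have hpb : p ≠ b m := by rintro rfl; simp [index] at hpm
  have hd₁ : ∀ x y, |Function.update h (a m) i x - Function.update h (a m) i y| ≤ dist x y :=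
    abs_update_sub_update_le hd fun y hy => by
      rw [abs_sub_comm]
      exact (hi y).trans (one_le_dist hy.symm)
  obtain ⟨f₁, -, hf₁⟩ := Lip0.exists_of_dist (p := p) _ hd₁ (by simp [hpa])
  obtain ⟨f, hf, hfx⟩ := Lip0.exists_of_dist (p := p) _
    (abs_update_sub_update_le (u := b m) (v := i + 1 - ε) hd₁ fun y hy => by
      by_cases hya : y = a m
      · subst hya
        rw [dist_comm, dist_a_b_of_le le_rfl, Function.update_self, abs_le]
        constructor <;> linarith
      · rw [Function.update_of_ne hya]
        have hiy := abs_le.1 (hi y)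
        rcases dist_b_eq_two_or m hy with h2 | ⟨l, hl, rfl | rfl⟩
        · rw [h2, abs_le]
          constructor <;> linarith
        · rw [dist_comm, dist_a_b_of_le hl, abs_le]
          constructor <;> linarith [(hm l hl).1]
        · rw [dist_comm, dist_c_b_of_le hl, abs_le]
          constructor <;> linarith [(hm l hl).2])
    (by simp [hpa, hpb])
  refine ⟨f, ⟨hf, ?_⟩, ?_⟩
  · have h1 := abs_lt.1 (ha f₁ h (fun y hy => by simp [hf₁, hy]) (by
      rw [hf₁, Function.update_self, abs_sub_comm]
      exact (hi (a m)).trans one_le_two))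
    have h2 := abs_lt.1 (hb f f₁ (fun y hy => by simp [hfx, hf₁, hy]) (by
      have hib := abs_le.1 (hi (b m))
      rw [hfx, hf₁, Function.update_self, Function.update_of_ne (by simp), abs_le]
      constructor <;> linarith))
    linarith
  · rw [hfx, hfx, Function.update_self, Function.update_of_ne (by simp), Function.update_self]
    ring

theorem hasSD2P (p : ABC) : HasSD2P (Lip0 p) := by
  intro n l S hl hl1 hS
  have hball : ∀ f ∈ ∑ i, l i • S i, ‖f‖ ≤ 1 := by
    intro f hf
    obtain ⟨g, hg, rfl⟩ := (Set.mem_fintype_sum _ _).1 hf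
    rw [← hl1]
    refine norm_sum_le_of_le _ fun i _ => ?_
    obtain ⟨k, hk, hgk⟩ := hg i
    obtain ⟨φ, α, -, -, hSi⟩ := hS i
    rw [hSi] at hk
    have hgk' : g i = l i • k := hgk.symm
    rw [hgk', norm_smul, Real.norm_of_nonneg (hl i)]
    exact mul_le_of_le_one_right (hl i) hk.1
  have hbdd : Bornology.IsBounded (∑ i, l i • S i) :=
    isBounded_iff_forall_norm_le.2 ⟨1, hball⟩
  refine le_antisymm (Metric.diam_le_of_forall_dist_le zero_le_two fun f hf g hg => ?_) ?_
  · rw [dist_eq_norm]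
    linarith [norm_sub_le f g, hball f hf, hball g hg]
  refine le_of_forall_pos_sub_le fun ε hε => ?_
  obtain ⟨η, hη, hη1, hηε⟩ : ∃ η : ℝ, 0 < η ∧ η ≤ 1 ∧ 2 * η ≤ ε :=
    ⟨min 1 (ε / 2), by positivity, min_le_left _ _, by linarith [min_le_right 1 (ε / 2)]⟩
  have hpos : ∀ i, ∀ᶠ m in atTop, ∃ f ∈ S i, f (b m) - f (a m) = 1 - η := by
    intro i
    obtain ⟨φ, α, hφ, hα, hSi⟩ := hS i
    obtain ⟨h, hh⟩ := exists_mem_sliceSet hφ hα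
    rw [hSi]
    exact eventually_exists_slope hh hη hη1
  -- The opposite slope is obtained from the slice `-S i`.
  have hneg : ∀ i, ∀ᶠ m in atTop, ∃ f ∈ S i, f (b m) - f (a m) = -(1 - η) := by
    intro i
    obtain ⟨φ, α, hφ, hα, hSi⟩ := hS i
    obtain ⟨h, hh⟩ := exists_mem_sliceSet (φ := -φ) (by simpa using hφ) hα
    filter_upwards [eventually_exists_slope hh hη hη1] with m ⟨f, hf, hfm⟩
    refine ⟨-f, ?_, ?_⟩
    · rw [hSi]
      exact ⟨by simpa using hf.1, by simpa using hf.2⟩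
    · simp only [Lip0.neg_apply]
      linarith
  obtain ⟨m, hm⟩ := (eventually_all.2 fun i => (hpos i).and (hneg i)).exists
  choose f hf hfm using fun i => (hm i).1
  choose g hg hgm using fun i => (hm i).2
  have hmem : ∀ k : Fin n → Lip0 p, (∀ i, k i ∈ S i) → ∑ i, l i • k i ∈ ∑ i, l i • S i :=
    fun k hk => (Set.mem_fintype_sum _ _).2 ⟨_, fun i => Set.smul_mem_smul_set (hk i), rfl⟩
  have hslope : ∀ (k : Fin n → Lip0 p) (r : ℝ), (∀ i, k i (b m) - k i (a m) = r) →
      (∑ i, l i • k i) (b m) - (∑ i, l i • k i) (a m) = r := by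
    intro k r hk
    simp only [Lip0.coe_sum, Lip0.smul_apply, ← Finset.sum_sub_distrib, ← mul_sub, hk]
    rw [← Finset.sum_mul, hl1, one_mul]
  have h1 := Metric.dist_le_diam_of_mem hbdd (hmem f hf) (hmem g hg)
  rw [dist_eq_norm] at h1
  refine le_trans ?_ h1
  have h2 := Lip0.abs_sub_le (∑ i, l i • f i - ∑ i, l i • g i) (b m) (a m)
  rw [dist_comm, dist_a_b_of_le le_rfl, mul_one] at h2
  refine le_trans ?_ ((le_abs_self _).trans h2)
  have h3 := hslope f _ hfm
  have h4 := hslope g _ hgm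
  simp only [Lip0.sub_apply]
  linarith

/-! ### Failure of the symmetric strong diameter two property -/

/-- The slice of the functional `f ↦ (f a₀ - f c₀) / 2` forces a symmetric perturbation to be
almost constant on the points `a_k`, `c_k`: each of these, if `k > 0`, is at distance `1` from both
`a₀` and `c₀`, so the values of `f + g` and `f - g` there are almost the midpoint of those at `a₀` and
`c₀`. -/
theorem abs_sub_le_of_first_slice {f g : Lip0 p} {α : ℝ}
    (hadd : ‖f + g‖ ≤ 1) (hsub : ‖f - g‖ ≤ 1)
    (hadd' : 2 - 2 * α < (f + g) (a 0) - (f + g) (c 0))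
    (hsub' : 2 - 2 * α < (f - g) (a 0) - (f - g) (c 0)) {x : ABC}
    (hx : ∃ k, x = a k ∨ x = c k) : |g x - g (a 0)| ≤ α := by
  have hd := Lip0.abs_sub_le_dist hadd
  have hd' := Lip0.abs_sub_le_dist hsub
  have hac := abs_le.1 (hd (a 0) (c 0))
  have hac' := abs_le.1 (hd' (a 0) (c 0))
  rw [dist_a_c_self] at hac hac'
  simp only [Lip0.add_apply, Lip0.sub_apply] at *
  have hmid : ∀ y, dist (a 0) y = 1 → dist y (c 0) = 1 → |g y - g (a 0)| ≤ α := by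
    intro y h1 h2
    have e1 := abs_le.1 (hd (a 0) y)
    have e2 := abs_le.1 (hd y (c 0))
    have e3 := abs_le.1 (hd' (a 0) y)
    have e4 := abs_le.1 (hd' y (c 0))
    rw [h1] at e1 e3
    rw [h2] at e2 e4
    rw [abs_le]
    constructor <;> linarith
  obtain ⟨k, rfl | rfl⟩ := hx <;> rcases Nat.eq_zero_or_pos k with rfl | hk
  · rw [sub_self, abs_zero]
    linarith
  · exact hmid _ (dist_a_of_index_lt hk) (dist_a_c hk.ne')
  · rw [abs_le]
    constructor <;> linarith
  · exact hmid _ (dist_c_of_index_lt hk) (by rw [dist_comm]; exact dist_c_of_index_lt hk)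

theorem not_hasSSD2P (p : ABC) : ¬ HasSSD2P (Lip0 p) := by
  intro H
  let φ₁ : StrongDual ℝ (Lip0 p) := (1 / 2 : ℝ) • (Lip0.delta (a 0) - Lip0.delta (c 0))
  have hφ₁ : ‖φ₁‖ = 1 := by
    let w : ABC → ℝ := Function.update (Function.update 0 (a 0) 1) (c 0) (-1)
    have hw : ∀ x y, |w x - w y| ≤ 1 * dist x y := by
      simp only [one_mul]
      refine abs_update_sub_update_le (abs_update_sub_update_le ?_ ?_) ?_
      · simp
      · intro y hy
        simpa using one_le_dist hy.symm
      · intro y hy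
        by_cases h : y = a 0
        · subst h
          rw [dist_comm, dist_a_c_self]
          norm_num
        · simpa [h] using one_le_dist hy.symm
    refine norm_eq_one_of_le_of_apply (x := Lip0.ofLipschitz p w hw) ?_
      (Lip0.norm_ofLipschitz_le _ zero_le_one _) ?_
    · rw [norm_smul]
      have h1 := Lip0.norm_delta_sub_le (p := p) (a 0) (c 0)
      rw [dist_a_c_self] at h1
      norm_num
      linarith
    · simp [φ₁, w]
      norm_num
  obtain ⟨φ₂, hφ₂le, hφ₂⟩ := exists_tendsto_hyperfilter
    (fun k => (Lip0.delta (a k) - Lip0.delta (c (k + 1)) : StrongDual ℝ (Lip0 p)))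
    fun k => (Lip0.norm_delta_sub_le _ _).trans (dist_a_c (by omega)).le
  have hφ₂1 : ‖φ₂‖ = 1 := by
    let w : ABC → ℝ := fun x => match x with
      | a _ => 1 / 2
      | b _ => 0
      | c _ => -1 / 2
    have hw : ∀ x, |w x| ≤ 1 / 2 := fun x => by cases x <;> norm_num [w, abs_of_neg]
    have hwd : ∀ x y, |w x - w y| ≤ 1 * dist x y := by
      intro x y
      by_cases hxy : x = y
      · simp [hxy]
      · linarith [abs_sub (w x) (w y), hw x, hw y, one_le_dist hxy]
    refine norm_eq_one_of_le_of_apply (x := Lip0.ofLipschitz p w hwd) hφ₂le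
      (Lip0.norm_ofLipschitz_le _ zero_le_one _) ?_
    refine tendsto_nhds_unique (hφ₂ _) (tendsto_const_nhds.congr fun k => ?_)
    simp [w]
    norm_num
  -- With `α = 1/16` the perturbation has norm at most `1/2 + 3α < 3/4`.
  obtain ⟨f, g, -, hg, hfg⟩ := H 2 two_pos ![sliceSet φ₁ (1 / 16), sliceSet φ₂ (1 / 16)]
    (Fin.forall_fin_two.2 ⟨⟨φ₁, _, hφ₁, by norm_num, rfl⟩, ⟨φ₂, _, hφ₂1, by norm_num, rfl⟩⟩)
    (1 / 4) (by norm_num)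
  obtain ⟨⟨-, hadd, hsub⟩, hf₂, hadd₂, hsub₂⟩ := Fin.forall_fin_two.1 hfg
  simp only [Matrix.cons_val_zero, Matrix.cons_val_one] at hadd hsub hf₂ hadd₂ hsub₂
  have hac : ∀ x, (∃ k, x = a k ∨ x = c k) → |g x - g (a 0)| ≤ 1 / 16 := by
    refine fun x hx => abs_sub_le_of_first_slice hadd.1 hsub.1 ?_ ?_ hx
    · have h1 : 1 - 1 / 16 < (1 / 2 : ℝ) * ((f 0 + g) (a 0) - (f 0 + g) (c 0)) := hadd.2
      linarith
    · have h1 : 1 - 1 / 16 < (1 / 2 : ℝ) * ((f 0 - g) (a 0) - (f 0 - g) (c 0)) := hsub.2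
      linarith
  have hb : ∀ m, |g (b m) - g (a 0)| ≤ 19 / 32 := by
    intro m
    have hev := (hφ₂ (f 1)).eventually_const_lt hf₂.2
    obtain ⟨k, hk, hmk⟩ := (hev.and (Nat.hyperfilter_le_atTop (eventually_ge_atTop m))).exists
    have hk' : 1 - 1 / 16 < f 1 (a k) - f 1 (c (k + 1)) := hk
    have e1 := abs_le.1 (Lip0.abs_sub_le_dist hadd₂.1 (a k) (b m))
    have e2 := abs_le.1 (Lip0.abs_sub_le_dist hadd₂.1 (c (k + 1)) (b m))
    have e3 := abs_le.1 (Lip0.abs_sub_le_dist hsub₂.1 (a k) (b m))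
    have e4 := abs_le.1 (Lip0.abs_sub_le_dist hsub₂.1 (c (k + 1)) (b m))
    rw [dist_a_b_of_le hmk] at e1 e3
    rw [dist_c_b_of_le (by omega)] at e2 e4
    have e5 := abs_le.1 (hac _ ⟨k, .inl rfl⟩)
    have e6 := abs_le.1 (hac _ ⟨k + 1, .inr rfl⟩)
    simp only [Lip0.add_apply, Lip0.sub_apply] at e1 e2 e3 e4
    rw [abs_le]
    constructor <;> linarith
  have hall : ∀ x, (∃ k, x = a k ∨ x = c k) ∨ ∃ m, x = b m := by
    rintro (k | k | k) <;> simp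
  have hnorm : ‖g‖ ≤ 3 / 4 := by
    refine Lip0.norm_le_of g (by norm_num) fun x y => ?_
    by_cases hxy : x = y
    · simp [hxy]
    have h1 := one_le_dist hxy
    rcases hall x with hx | ⟨k, rfl⟩ <;> rcases hall y with hy | ⟨l, rfl⟩
    · have e1 := abs_le.1 (hac x hx)
      have e2 := abs_le.1 (hac y hy)
      rw [abs_le]
      constructor <;> linarith
    · have e1 := abs_le.1 (hac x hx)
      have e2 := abs_le.1 (hb l)
      rw [abs_le]
      constructor <;> linarith
    · have e1 := abs_le.1 (hb k)
      have e2 := abs_le.1 (hac y hy)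
      rw [abs_le]
      constructor <;> linarith
    · have e1 := abs_le.1 (hb k)
      have e2 := abs_le.1 (hb l)
      rw [dist_b_b (by rintro rfl; exact hxy rfl), abs_le]
      constructor <;> linarith
  linarith

end ABC

theorem mainTheorem2 :
    (∀ p : ABC,
      HasSD2P (Lip0 p) ∧ ¬ HasSSD2P (Lip0 p) ∧ HasWeakStarSSD2P (Lip0.dualIso p)) ∧
    HasSLTP ABC ∧
    (∃ (X : Type) (_ : NormedAddCommGroup X) (_ : NormedSpace ℝ X) (_ : CompleteSpace X),
      HasWeakStarSSD2P (LinearIsometryEquiv.refl ℝ (StrongDual ℝ X)) ∧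
      ¬ HasSSD2P (StrongDual ℝ X)) := by
  refine ⟨fun p => ⟨ABC.hasSD2P p, ABC.not_hasSSD2P p, ABC.hasWeakStarSSD2P p⟩, ABC.hasSLTP,
    LipFree (ABC.a 0), inferInstance, inferInstance, inferInstance,
    (ABC.hasWeakStarSSD2P _).strongDual, fun h => ?_⟩
  exact ABC.not_hasSSD2P (ABC.a 0) (h.of_linearIsometryEquiv (Lip0.dualIso _).symm)
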